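/- Let $D$ be a finite (nonempty) distributive lattice with least element $0$ and greatest element $1$. Let $J(D)$ be the set of its nonzero join-irreducible elements and $J^+(D)=J(D)\cup\{0,1\}$. A $J(D)$-colored chain consists of a finite nonempty chain $C$ and a surjective map $\gamma$ from the set of prime intervals $[x,y]$ ($x\prec y$) of $C$ onto $J(D)$. The element of $D$ represented by an interval $I=[x,y]$ ($x\le y$) of $C$ is the join in $D$ of the colors $\gamma(\mathfrak p)$ of all prime intervals $\mathfrak p$ of $C$ contained in $I$ (the empty join being $0$), and the set represented by the colored chain is the set of the elements represented by all intervals of $C$. The lattice $D$ is called fully chain-representable if every set $Q$ with $J^+(D)\subseteq Q\subseteq D$ is the set represented by some $J(D)$-colored chain. The lattice $D$ is called planar if it has a planar Hasse diagram, that is, its elements can be drawn as distinct points of the plane, larger elements placed higher, with each covering pair $a\prec b$ drawn as a straight line segment, so that these segments pass through no elements other than their endpoints and two distinct segments meet at most in a common endpoint. An element is join-reducible if it is the join of two strictly smaller elements. Then $D$ is fully chain-representable if and only if $D$ is planar and has at most one join-reducible coatom. -/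

import Mathlib

/-- The nonzero join-irreducible elements `J(D)` (`SupIrred` excludes the least element). -/
abbrev JoinIrr (D : Type*) [SemilatticeSup D] : Type _ := {a : D // SupIrred a}

/-- `J⁺(D)`: the nonzero join-irreducible elements together with `0` and `1`. -/
def JPlus (D : Type*) [SemilatticeSup D] [BoundedOrder D] : Set D :=
  {a | SupIrred a} ∪ {⊥, ⊤}

/-- `a` is the join of two elements strictly below it. -/
def JoinReducible {D : Type*} [SemilatticeSup D] (a : D) : Prop :=
  ∃ b c : D, b < a ∧ c < a ∧ b ⊔ c = a

/-- The prime intervals `[x, y]`, `x ⋖ y`, of an ordered set, given by their endpoints. -/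
abbrev PrimeInterval (C : Type*) [Preorder C] : Type _ := {p : C × C // p.1 ⋖ p.2}

/-- The element of `D` represented by an interval `I` of a chain `C` whose prime intervals are
colored by `J(D)`: the join of the colors of all prime intervals of `C` contained in `I`
(so `⊥` if `I` is a singleton). -/
noncomputable def intervalRep {C D : Type*} [LinearOrder C] [Finite C]
    [SemilatticeSup D] [OrderBot D] (color : PrimeInterval C → JoinIrr D)
    (I : NonemptyInterval C) : D :=
  (Set.toFinite {p : PrimeInterval C | I.fst ≤ p.1.1 ∧ p.1.2 ≤ I.snd}).toFinset.sup
    fun p => (color p : D)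

/-- The set represented by a colored chain. -/
def representedSet {C D : Type*} [LinearOrder C] [Finite C]
    [SemilatticeSup D] [OrderBot D] (color : PrimeInterval C → JoinIrr D) : Set D :=
  Set.range (intervalRep color)

/-- The inclusion `Q ⊆ D` is chain-representable: `Q` is the set represented by some finite
(nonempty) chain `C` with a surjective coloring of its prime intervals by `J(D)`.
Every finite chain has an isomorphic copy in `Type`. -/
def ChainRepresentable {D : Type*} [SemilatticeSup D] [OrderBot D] (Q : Set D) : Prop :=
  ∃ (C : Type) (_ : LinearOrder C) (_ : Finite C) (_ : Nonempty C)
    (color : PrimeInterval C → JoinIrr D),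
    Function.Surjective color ∧ Q = representedSet color

/-- Every `Q` with `J⁺(D) ⊆ Q ⊆ D` is chain-representable. -/
def FullyChainRepresentable (D : Type*) [SemilatticeSup D] [BoundedOrder D] : Prop :=
  ∀ Q : Set D, JPlus D ⊆ Q → ChainRepresentable Q

/-- `pos` is a planar (Hasse) diagram of the ordered set `D`: distinct elements are distinct
points of the plane, larger elements are placed higher, each covering pair `a ⋖ b` is drawn as the
straight line segment from `pos a` to `pos b`, edges pass through no elements other than their
endpoints, and two distinct edges meet at most at a common endpoint. -/
structure IsPlanarDiagram {D : Type*} [PartialOrder D] (pos : D → ℝ × ℝ) : Prop where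
  injective : Function.Injective pos
  upward : ∀ a b : D, a < b → (pos a).2 < (pos b).2
  vertex_edge : ∀ a b v : D, a ⋖ b → pos v ∈ segment ℝ (pos a) (pos b) → v = a ∨ v = b
  edge_edge : ∀ a b c d : D, a ⋖ b → c ⋖ d → (a, b) ≠ (c, d) →
    ∀ P : ℝ × ℝ, P ∈ segment ℝ (pos a) (pos b) → P ∈ segment ℝ (pos c) (pos d) →
      ∃ v : D, (v = a ∨ v = b) ∧ (v = c ∨ v = d) ∧ P = pos v

/-- A finite ordered set is planar if it has a planar diagram. -/
def IsPlanarOrder (D : Type*) [PartialOrder D] : Prop :=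
  Finite D ∧ ∃ pos : D → ℝ × ℝ, IsPlanarDiagram pos

/-!
Reading the colors of a colored chain from the bottom up gives a word over `J(D)`, and the
represented elements are the joins of the factors of this word. Both sides of the equivalence are
linked by the condition that `J(D)` has width at most two.

If `a`, `b`, `c` form an antichain in `J(D)`, represent `J⁺(D) ∪ {a ⊔ b ⊔ c}`: extending a factor
letter by letter, its join cannot pass from below one of `a`, `b`, `c` to `a ⊔ b ⊔ c`. If `c` and
`c'` are distinct join-reducible coatoms, represent `J⁺(D) ∪ {c ⊓ c'}`: a factor with join
`c ⊓ c'` keeps this join however it is extended, although the whole word has join `⊤`.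

Conversely, if `J(D)` has width at most two, every nonzero element is the join of two members of
`J(D)`, and if moreover there is at most one join-reducible coatom, some `p` in `J(D)` is equal to
`⊤` or covered by it. The word listing the pairs with join in `Q`, separated by the letter `p`,
represents `Q`, because a factor containing `p` has join `p` or `⊤`.

If `J(D)` has width at most two, it is the union of two chains (Dilworth), and counting the elements
below `a` in each of them embeds `D` into the grid `ℕ × ℕ` so that covers become unit steps. On the
other hand, an antichain `a`, `b`, `c` in `J(D)` and an element `x` maximal among those above none
of the three yield the covers `x ⊔ a`, `x ⊔ b`, `x ⊔ c` of `x`, none of which is below the join of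
the other two. In a planar diagram the middle one of three covers is enclosed by paths from the
outer two to their join, hence lies below that join.
-/

section Words

variable {C D : Type*} [SemilatticeSup D] [OrderBot D]

/-- The join of the letters of a word over `D`. -/
def wordSup (u : List D) : D := (u : Multiset D).sup

/-- The joins of the factors (contiguous subwords) of a word. Listing the colors of the prime
intervals of a colored chain from the bottom up gives a word, and the factors of this word
correspond to the intervals of the chain. -/
def factorSups (w : List D) : Set D := wordSup '' {u | u <:+: w}

theorem wordSup_le_iff {u : List D} {z : D} : wordSup u ≤ z ↔ ∀ x ∈ u, x ≤ z := by
  rw [wordSup, Multiset.sup_le]; rfl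

theorem le_wordSup {u : List D} {x : D} (hx : x ∈ u) : x ≤ wordSup u :=
  wordSup_le_iff.1 le_rfl x hx

@[simp] theorem wordSup_nil : wordSup ([] : List D) = ⊥ := rfl

@[simp] theorem wordSup_cons (x : D) (u : List D) : wordSup (x :: u) = x ⊔ wordSup u :=
  eq_of_forall_ge_iff fun z => by simp [wordSup_le_iff]

@[simp] theorem wordSup_append (u v : List D) : wordSup (u ++ v) = wordSup u ⊔ wordSup v :=
  eq_of_forall_ge_iff fun z => by simp [wordSup_le_iff, or_imp, forall_and]

theorem wordSup_mem_factorSups {u w : List D} (h : u <:+: w) : wordSup u ∈ factorSups w :=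
  ⟨u, h, rfl⟩

theorem factorSups_mono {u w : List D} (h : u <:+: w) : factorSups u ⊆ factorSups w :=
  Set.image_mono fun _ hv => hv.trans h

theorem infix_iff_exists_take_drop {α : Type*} {u w : List α} :
    u <:+: w ↔ ∃ i j, i ≤ j ∧ j ≤ w.length ∧ (w.take j).drop i = u := by
  constructor
  · rintro ⟨s, t, rfl⟩
    refine ⟨s.length, s.length + u.length, by simp, by simp, ?_⟩
    rw [← List.length_append, List.take_left, List.drop_left]
  · rintro ⟨i, j, -, -, rfl⟩
    exact (List.drop_suffix _ _).isInfix.trans (List.take_prefix _ _).isInfix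

theorem PrimeInterval.coe_apply_snd [LinearOrder C] {n : ℕ} (e : C ≃o Fin (n + 1))
    (p : PrimeInterval C) : (e p.1.2 : ℕ) = e p.1.1 + 1 :=
  (Nat.covBy_iff_add_one_eq.1 (Fin.covBy_iff.1 ((apply_covBy_apply_iff e).2 p.2))).symm

/-- The prime intervals of an `(n + 1)`-element chain, numbered from the bottom up. -/
@[simps]
def primeIntervalEquiv [LinearOrder C] {n : ℕ} (e : C ≃o Fin (n + 1)) :
    PrimeInterval C ≃ Fin n where
  toFun p := ⟨e p.1.1, by have := PrimeInterval.coe_apply_snd e p; omega⟩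
  invFun i := ⟨(e.symm i.castSucc, e.symm i.succ), by
    rw [apply_covBy_apply_iff, Fin.covBy_iff]
    exact Nat.covBy_iff_add_one_eq.2 rfl⟩
  left_inv p := by
    refine Subtype.ext (Prod.ext ?_ ?_)
    · simp
    · rw [OrderIso.symm_apply_eq]
      exact Fin.ext (PrimeInterval.coe_apply_snd e p).symm
  right_inv i := by ext; simp

/-- The word of the colors of the prime intervals of an `(n + 1)`-element chain. -/
def colorWord [LinearOrder C] {n : ℕ} (e : C ≃o Fin (n + 1))
    (color : PrimeInterval C → JoinIrr D) : List D :=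
  List.ofFn fun i => (color ((primeIntervalEquiv e).symm i) : D)

theorem intervalRep_le_iff [LinearOrder C] [Finite C] {color : PrimeInterval C → JoinIrr D}
    {I : NonemptyInterval C} {z : D} :
    intervalRep color I ≤ z ↔
      ∀ p : PrimeInterval C, I.fst ≤ p.1.1 → p.1.2 ≤ I.snd → (color p : D) ≤ z := by
  simp [intervalRep, Finset.sup_le_iff]

theorem wordSup_factor_ofFn_le_iff {n : ℕ} {f : Fin n → D} {i j : ℕ} {z : D} :
    wordSup (((List.ofFn f).take j).drop i) ≤ z ↔ ∀ k : Fin n, i ≤ k → k < j → f k ≤ z := by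
  rw [wordSup_le_iff]
  constructor
  · refine fun h k hi hj => h _ (List.mem_drop_iff_getElem.2 ⟨k - i, ?_, ?_⟩)
    · rw [List.length_take, List.length_ofFn]; omega
    · simp [Nat.add_sub_cancel' hi]
  · intro h x hx
    obtain ⟨k, hk, rfl⟩ := List.mem_drop_iff_getElem.1 hx
    simp only [List.length_take, List.length_ofFn, lt_min_iff] at hk
    simpa using h ⟨i + k, by omega⟩ (Nat.le_add_right i k) (by dsimp only; omega)

theorem intervalRep_eq_wordSup [LinearOrder C] [Finite C] {n : ℕ} (e : C ≃o Fin (n + 1))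
    (color : PrimeInterval C → JoinIrr D) (I : NonemptyInterval C) :
    intervalRep color I = wordSup (((colorWord e color).take (e I.snd)).drop (e I.fst)) := by
  refine eq_of_forall_ge_iff fun z => ?_
  rw [intervalRep_le_iff, colorWord, wordSup_factor_ofFn_le_iff,
    (primeIntervalEquiv e).symm.forall_congr_left]
  refine forall_congr' fun p => ?_
  simp only [Equiv.symm_symm, Equiv.symm_apply_apply, ← e.le_iff_le, Fin.le_def,
    PrimeInterval.coe_apply_snd, primeIntervalEquiv_apply_val, Nat.succ_le_iff]

theorem representedSet_eq_factorSups [LinearOrder C] [Finite C] {n : ℕ} (e : C ≃o Fin (n + 1))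
    (color : PrimeInterval C → JoinIrr D) :
    representedSet color = factorSups (colorWord e color) := by
  ext d
  constructor
  · rintro ⟨I, rfl⟩
    rw [intervalRep_eq_wordSup e]
    exact wordSup_mem_factorSups (infix_iff_exists_take_drop.2
      ⟨_, _, e.le_iff_le.2 I.fst_le_snd, by rw [colorWord, List.length_ofFn]; omega, rfl⟩)
  · rintro ⟨u, hu, rfl⟩
    obtain ⟨i, j, hij, hj, rfl⟩ := infix_iff_exists_take_drop.1 hu
    rw [colorWord, List.length_ofFn] at hj
    refine ⟨⟨(e.symm ⟨i, by omega⟩, e.symm ⟨j, by omega⟩), by simpa using hij⟩, ?_⟩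
    simp [intervalRep_eq_wordSup e]

theorem chainRepresentable_iff {Q : Set D} :
    ChainRepresentable Q ↔ ∃ w : List D, (∀ x, x ∈ w ↔ SupIrred x) ∧ Q = factorSups w := by
  constructor
  · rintro ⟨C, _, _, _, color, hcolor, rfl⟩
    have := Fintype.ofFinite C
    obtain ⟨n, hn⟩ := Nat.exists_eq_add_one_of_ne_zero (Fintype.card_ne_zero (α := C))
    let e : C ≃o Fin (n + 1) := (Fintype.orderIsoFinOfCardEq C hn).symm
    refine ⟨colorWord e color, fun x => ?_, representedSet_eq_factorSups e color⟩
    simp only [colorWord, List.mem_ofFn]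
    constructor
    · rintro ⟨i, rfl⟩
      exact (color _).2
    · intro hx
      obtain ⟨p, hp⟩ := hcolor ⟨x, hx⟩
      exact ⟨primeIntervalEquiv e p, by simp [hp]⟩
  · rintro ⟨w, hw, rfl⟩
    let e := OrderIso.refl (Fin (w.length + 1))
    let color (p : PrimeInterval (Fin (w.length + 1))) : JoinIrr D :=
      ⟨w.get (primeIntervalEquiv e p), (hw _).1 (List.get_mem _ _)⟩
    refine ⟨Fin (w.length + 1), inferInstance, inferInstance, inferInstance, color, ?_, ?_⟩
    · rintro ⟨x, hx⟩
      obtain ⟨i, rfl⟩ := List.get_of_mem ((hw x).2 hx)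
      exact ⟨(primeIntervalEquiv e).symm i, by simp [color]⟩
    · rw [representedSet_eq_factorSups e]
      simp [colorWord, color]

end Words

section JoinIrreducibles

variable {D : Type*}

theorem joinReducible_iff [SemilatticeSup D] {a : D} :
    JoinReducible a ↔ ¬IsMin a ∧ ¬SupIrred a := by
  rw [not_supIrred]
  constructor
  · rintro ⟨b, c, hb, hc, h⟩
    exact ⟨hb.not_isMin, .inr ⟨b, c, h, hb, hc⟩⟩
  · rintro ⟨ha, ha' | ⟨b, c, h, hb, hc⟩⟩
    · exact absurd ha' ha
    · exact ⟨b, c, hb, hc, h⟩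

theorem le_of_forall_supIrred_le [SemilatticeSup D] [OrderBot D] [WellFoundedLT D] {d z : D}
    (h : ∀ x, SupIrred x → x ≤ d → x ≤ z) : d ≤ z := by
  obtain ⟨s, rfl, hs⟩ := exists_supIrred_decomposition d
  exact Finset.sup_le fun x hx => h x (hs hx) (Finset.le_sup (f := id) hx)

theorem wordSup_eq_top [SemilatticeSup D] [BoundedOrder D] [WellFoundedLT D] {w : List D}
    (hw : ∀ x, SupIrred x → x ∈ w) : wordSup w = ⊤ :=
  top_le_iff.1 (le_of_forall_supIrred_le fun x hx _ => le_wordSup (hw x hx))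

/-- Among any three elements of `s` two are comparable: for a finite partially ordered set `s`,
the antichains of `s` have at most two elements. -/
def WidthLETwo [LE D] (s : Set D) : Prop :=
  ∀ a ∈ s, ∀ b ∈ s, ∀ c ∈ s, a ≤ b ∨ b ≤ a ∨ a ≤ c ∨ c ≤ a ∨ b ≤ c ∨ c ≤ b

end JoinIrreducibles

section Necessity

variable {D : Type*} [DistribLattice D] [BoundedOrder D]

/-- Adding a letter to a word below `a`, `b` or `c` yields a word that lies again below one of them:
its join cannot be `a ⊔ b ⊔ c`, since two join-irreducible elements do not cover three. -/
theorem wordSup_le_of_antichain {a b c : D} (ha : SupIrred a) (hb : SupIrred b) (hc : SupIrred c)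
    (hab : ¬a ≤ b) (hba : ¬b ≤ a) (hac : ¬a ≤ c) (hca : ¬c ≤ a) (hbc : ¬b ≤ c) (hcb : ¬c ≤ b)
    {u : List D} (hirr : ∀ x ∈ u, SupIrred x)
    (hu : factorSups u ⊆ JPlus D ∪ {a ⊔ b ⊔ c}) (hle : wordSup u ≤ a ⊔ b ⊔ c) :
    wordSup u ≤ a ∨ wordSup u ≤ b ∨ wordSup u ≤ c := by
  have le_one {d : D} (hd : SupIrred d) (h : d ≤ a ⊔ b ⊔ c) : d ≤ a ∨ d ≤ b ∨ d ≤ c := by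
    rwa [hd.supPrime.le_sup, hd.supPrime.le_sup, or_assoc] at h
  induction u with
  | nil => simp
  | cons x u ih =>
    have not_ge : ¬a ⊔ b ⊔ c ≤ wordSup (x :: u) := by
      rw [wordSup_cons] at hle ⊢
      rw [sup_le_iff] at hle
      have hx := le_one (hirr x List.mem_cons_self) hle.1
      have hu := ih (fun y hy => hirr y (List.mem_cons_of_mem x hy))
        ((factorSups_mono (List.suffix_cons x u).isInfix).trans hu) hle.2
      rw [sup_le_iff, sup_le_iff, ha.supPrime.le_sup, hb.supPrime.le_sup, hc.supPrime.le_sup]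
      grind
    rcases hu (wordSup_mem_factorSups List.infix_rfl) with (h | h | h) | h
    · exact le_one h hle
    · exact .inl (h.trans_le bot_le)
    · exact absurd (le_top.trans_eq h.symm) not_ge
    · exact absurd (Eq.ge h) not_ge

namespace FullyChainRepresentable

theorem widthLETwo (h : FullyChainRepresentable D) : WidthLETwo {a : D | SupIrred a} := by
  intro a ha b hb c hc
  by_contra! hcon
  obtain ⟨hab, hba, hac, hca, hbc, hcb⟩ := hcon
  obtain ⟨w, hirr, hw⟩ :=
    chainRepresentable_iff.1 (h (JPlus D ∪ {a ⊔ b ⊔ c}) Set.subset_union_left)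
  obtain ⟨u, hu, hsup⟩ : a ⊔ b ⊔ c ∈ factorSups w := hw ▸ Or.inr rfl
  have := wordSup_le_of_antichain ha hb hc hab hba hac hca hbc hcb
    (fun x hx => (hirr x).1 (hu.subset hx)) ((factorSups_mono hu).trans_eq hw.symm) hsup.le
  rw [hsup] at this
  simp only [sup_le_iff] at this
  tauto

theorem finite (h : FullyChainRepresentable D) : Finite D := by
  obtain ⟨C, _, _, _, color, -, hD⟩ := h Set.univ (Set.subset_univ _)
  have := Finite.of_injective _ (NonemptyInterval.toProd_injective (α := C))
  exact Set.finite_univ_iff.1 (hD ▸ Set.finite_range _)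

end FullyChainRepresentable

theorem infix_induction {α : Type*} {p : List α → Prop} {u w : List α} (h : u <:+: w) (hu : p u)
    (cons : ∀ x v, x :: v <:+: w → p v → p (x :: v))
    (concat : ∀ x v, v ++ [x] <:+: w → p v → p (v ++ [x])) : p w := by
  obtain ⟨s, t, rfl⟩ := h
  have left (r) (hr : r ++ u <:+: s ++ u ++ t) : p (r ++ u) := by
    induction r with
    | nil => exact hu
    | cons x r ih => exact cons x _ hr (ih ((List.suffix_cons x _).isInfix.trans hr))
  have right (r) (hr : s ++ u ++ r <:+: s ++ u ++ t) : p (s ++ u ++ r) := by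
    induction r using List.reverseRecOn with
    | nil => simpa using left s ((List.prefix_append _ t).isInfix)
    | append_singleton r x ih =>
      rw [← List.append_assoc] at hr ⊢
      exact concat x _ hr (ih ((List.prefix_append _ _).isInfix.trans hr))
  exact right t List.infix_rfl

theorem wordSup_eq_of_absorbing {D : Type*} [SemilatticeSup D] [OrderBot D] {m : D}
    {u w : List D} (h : u <:+: w) (hu : wordSup u = m)
    (hm : ∀ x ∈ w, m ⊔ x ∈ factorSups w → m ⊔ x = m) : wordSup w = m := by
  refine infix_induction (p := (wordSup · = m)) h hu (fun x v hv hvm => ?_) (fun x v hv hvm => ?_)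
  · have hsup : wordSup (x :: v) = m ⊔ x := by rw [wordSup_cons, hvm, sup_comm]
    rw [hsup]
    exact hm x (hv.subset (by simp)) (hsup ▸ wordSup_mem_factorSups hv)
  · have hsup : wordSup (v ++ [x]) = m ⊔ x := by simp [hvm]
    rw [hsup]
    exact hm x (hv.subset (by simp)) (hsup ▸ wordSup_mem_factorSups hv)

theorem inf_sup_eq_inf_of_mem {c c' x : D} (hc : IsCoatom c) (hred : JoinReducible c)
    (hc' : IsCoatom c') (hne : c ≠ c') (hx : x ≤ c) (h : c ⊓ c' ⊔ x ∈ JPlus D ∪ {c ⊓ c'}) :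
    c ⊓ c' ⊔ x = c ⊓ c' := by
  have hcov : c ⊓ c' ⋖ c :=
    inf_covBy_of_covBy_sup_right (hc.sup_eq_top_of_ne hc' hne ▸ hc'.covBy_top)
  refine (hcov.wcovBy.eq_or_eq le_sup_left (sup_le inf_le_left hx)).resolve_right fun hsup => ?_
  rw [joinReducible_iff, isMin_iff_eq_bot] at hred
  rcases hsup ▸ h with (h | h | h) | h
  · exact hred.2 h
  · exact hred.1 h
  · exact hc.1 h
  · exact hcov.ne' h

theorem FullyChainRepresentable.subsingleton_joinReducible_coatom
    (h : FullyChainRepresentable D) : {c : D | IsCoatom c ∧ JoinReducible c}.Subsingleton := by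
  rintro c ⟨hc, hred⟩ c' ⟨hc', hred'⟩
  by_contra hne
  have := h.finite
  obtain ⟨w, hirr, hw⟩ :=
    chainRepresentable_iff.1 (h (JPlus D ∪ {c ⊓ c'}) Set.subset_union_left)
  obtain ⟨u, hu, hsup⟩ : c ⊓ c' ∈ factorSups w := hw ▸ Or.inr rfl
  have habs : ∀ x ∈ w, c ⊓ c' ⊔ x ∈ factorSups w → c ⊓ c' ⊔ x = c ⊓ c' := by
    intro x hxw hx
    rw [← hw] at hx
    have hle : x ≤ c ⊔ c' := hc.sup_eq_top_of_ne hc' hne ▸ le_top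
    rcases ((hirr x).1 hxw).supPrime.le_sup.1 hle with hxc | hxc
    · exact inf_sup_eq_inf_of_mem hc hred hc' hne hxc hx
    · rw [inf_comm] at hx ⊢
      exact inf_sup_eq_inf_of_mem hc' hred' hc (Ne.symm hne) hxc hx
  have htop : c ⊓ c' = ⊤ :=
    (wordSup_eq_of_absorbing hu hsup habs).symm.trans (wordSup_eq_top fun x => (hirr x).2)
  exact hc.1 (top_le_iff.1 (htop.ge.trans inf_le_left))

end Necessity

section Sufficiency

variable {D : Type*}

/-- The word listing the given pairs of letters, each pair followed by the separating letter
`p`. -/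
def separatedWord (p : D) (L : List (D × D)) : List D := L.flatMap fun q => [q.1, q.2, p]

theorem mem_separatedWord {p x : D} {L : List (D × D)} :
    x ∈ separatedWord p L ↔ ∃ q ∈ L, x = q.1 ∨ x = q.2 ∨ x = p := by
  simp [separatedWord]

theorem mem_or_infix_of_infix_append_cons {p : D} {u s t : List D} (h : u <:+: s ++ p :: t) :
    p ∈ u ∨ u <:+: s ∨ u <:+: t := by
  rcases List.infix_append_iff.1 h with h | h | ⟨v, r, rfl, hv, hr⟩
  · exact .inr (.inl h)
  · rcases List.infix_cons_iff.1 h with h | h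
    · rcases List.prefix_cons_iff.1 h with rfl | ⟨r, rfl, -⟩
      · exact .inr (.inl List.nil_infix)
      · exact .inl List.mem_cons_self
    · exact .inr (.inr h)
  · rcases List.prefix_cons_iff.1 hr with rfl | ⟨r, rfl, -⟩
    · exact .inr (.inl (by simpa using hv.isInfix))
    · exact .inl (by simp)

theorem mem_or_infix_pair_of_infix_separatedWord {p : D} {L : List (D × D)} {u : List D}
    (h : u <:+: separatedWord p L) : p ∈ u ∨ u = [] ∨ ∃ q ∈ L, u <:+: [q.1, q.2] := by
  induction L with
  | nil => exact .inr (.inl (List.infix_nil.1 h))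
  | cons q L ih =>
    rcases mem_or_infix_of_infix_append_cons (s := [q.1, q.2]) h with h | h | h
    · exact .inl h
    · exact .inr (.inr ⟨q, List.mem_cons_self, h⟩)
    · rcases ih h with h | h | ⟨r, hr, h⟩
      · exact .inl h
      · exact .inr (.inl h)
      · exact .inr (.inr ⟨r, List.mem_cons_of_mem q hr, h⟩)

theorem pair_infix_separatedWord {p : D} {L : List (D × D)} {q : D × D} (hq : q ∈ L) :
    [q.1, q.2] <:+: separatedWord p L :=
  (List.prefix_append [q.1, q.2] [p]).isInfix.trans
    (List.infix_of_mem_flatten (List.mem_map_of_mem hq))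

theorem mem_factorSups_separatedWord [SemilatticeSup D] [OrderBot D] {p d : D} {L : List (D × D)}
    (h : d ∈ factorSups (separatedWord p L)) :
    p ≤ d ∨ d = ⊥ ∨ ∃ q ∈ L, d = q.1 ∨ d = q.2 ∨ d = q.1 ⊔ q.2 := by
  obtain ⟨u, hu, rfl⟩ := h
  rcases mem_or_infix_pair_of_infix_separatedWord hu with hp | rfl | ⟨q, hq, hu⟩
  · exact .inl (le_wordSup hp)
  · exact .inr (.inl wordSup_nil)
  · simp only [List.infix_cons_iff, List.prefix_cons_iff, List.prefix_nil, List.infix_nil] at hu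
    rcases hu with (rfl | ⟨_, rfl, rfl | ⟨_, rfl, rfl⟩⟩) | (rfl | ⟨_, rfl, rfl⟩) | rfl
    all_goals simp only [wordSup_nil, wordSup_cons, sup_bot_eq]
    all_goals grind

theorem exists_supIrred_wcovBy_top [Lattice D] [BoundedOrder D] [IsCoatomic D] [Nontrivial D]
    (h : {c : D | IsCoatom c ∧ JoinReducible c}.Subsingleton) :
    ∃ p : D, SupIrred p ∧ p ⩿ ⊤ := by
  by_cases htop : SupIrred (⊤ : D)
  · exact ⟨⊤, htop, WCovBy.refl _⟩
  obtain ⟨b, c, hb, hc, hbc⟩ := joinReducible_iff.2 ⟨not_isMin_top, htop⟩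
  obtain ⟨b', hb', hbb'⟩ := (eq_top_or_exists_le_coatom b).resolve_left hb.ne
  obtain ⟨c', hc', hcc'⟩ := (eq_top_or_exists_le_coatom c).resolve_left hc.ne
  have hsup : b' ⊔ c' = ⊤ := top_le_iff.1 (hbc ▸ sup_le_sup hbb' hcc')
  by_contra! hcon
  have joinReducible_of_coatom {e f : D} (he : IsCoatom e) (hf : IsCoatom f) (hef : e ⊔ f = ⊤) :
      JoinReducible e := by
    refine joinReducible_iff.2 ⟨fun hmin => hf.1 ?_, fun hirr => hcon e hirr he.covBy_top.wcovBy⟩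
    rwa [hmin.eq_bot, bot_sup_eq] at hef
  have heq : b' = c' := h ⟨hb', joinReducible_of_coatom hb' hc' hsup⟩
    ⟨hc', joinReducible_of_coatom hc' hb' (sup_comm b' c' ▸ hsup)⟩
  exact hb'.1 (by rwa [← heq, sup_idem] at hsup)

namespace WidthLETwo

variable [DistribLattice D]

theorem exists_supIrred_sup_eq [OrderBot D] [Finite D] (h : WidthLETwo {a : D | SupIrred a})
    {y : D} (hy : y ≠ ⊥) : ∃ a b : D, SupIrred a ∧ SupIrred b ∧ a ⊔ b = y := by
  obtain ⟨x, hx, hxy⟩ : ∃ x, SupIrred x ∧ x ≤ y := by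
    by_contra! hcon
    exact hy (le_bot_iff.1 (le_of_forall_supIrred_le fun x hx hxy => (hcon x hx hxy).elim))
  obtain ⟨d, -, ⟨⟨a, b, ha, hb, rfl⟩, hle⟩, hmax⟩ := Finite.exists_le_maximal
    (p := fun d => (∃ a b, SupIrred a ∧ SupIrred b ∧ a ⊔ b = d) ∧ d ≤ y)
    ⟨⟨x, x, hx, hx, sup_idem x⟩, hxy⟩
  refine ⟨a, b, ha, hb, hle.antisymm (le_of_forall_supIrred_le fun z hz hzy => ?_)⟩
  have le_of_le {c d : D} (hc : SupIrred c) (hd : SupIrred d) (hcy : c ≤ y) (hdy : d ≤ y)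
      (h : a ⊔ b ≤ c ⊔ d) : c ⊔ d ≤ a ⊔ b :=
    hmax ⟨⟨c, d, hc, hd, rfl⟩, sup_le hcy hdy⟩ h
  obtain ⟨hay, hby⟩ := sup_le_iff.1 hle
  rcases h a ha b hb z hz with h | h | h | h | h | h
  · exact (le_of_le hb hz hby hzy (sup_le (h.trans le_sup_left) le_sup_left)).trans' le_sup_right
  · exact (le_of_le ha hz hay hzy (sup_le le_sup_left (h.trans le_sup_left))).trans' le_sup_right
  · exact (le_of_le hz hb hzy hby (sup_le_sup_right h b)).trans' le_sup_left
  · exact h.trans le_sup_left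
  · exact (le_of_le ha hz hay hzy (sup_le_sup_left h a)).trans' le_sup_right
  · exact h.trans le_sup_right

theorem factorSups_separatedWord_eq [BoundedOrder D] [Finite D]
    (hW : WidthLETwo {a : D | SupIrred a}) {p : D} (hp : SupIrred p) (hpt : p ⩿ ⊤) {Q : Set D}
    (hQ : JPlus D ⊆ Q) {L : List (D × D)}
    (hL : ∀ q, q ∈ L ↔ SupIrred q.1 ∧ SupIrred q.2 ∧ q.1 ⊔ q.2 ∈ Q) :
    factorSups (separatedWord p L) = Q := by
  refine Set.Subset.antisymm (fun d hd => ?_) fun d hd => ?_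
  · rcases mem_factorSups_separatedWord hd with hpd | rfl | ⟨q, hq, hd⟩
    · rcases hpt.eq_or_eq hpd le_top with rfl | rfl
      exacts [hQ (.inl hp), hQ (.inr (.inr rfl))]
    · exact hQ (.inr (.inl rfl))
    · obtain ⟨h1, h2, h12⟩ := (hL q).1 hq
      rcases hd with rfl | rfl | rfl
      exacts [hQ (.inl h1), hQ (.inl h2), h12]
  · rcases eq_or_ne d ⊥ with rfl | hd0
    · exact wordSup_mem_factorSups List.nil_infix
    · obtain ⟨a, b, ha, hb, rfl⟩ := hW.exists_supIrred_sup_eq hd0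
      simpa using wordSup_mem_factorSups (pair_infix_separatedWord (p := p)
        ((hL (a, b)).2 ⟨ha, hb, hd⟩))

theorem fullyChainRepresentable [BoundedOrder D] [Finite D] (hW : WidthLETwo {a : D | SupIrred a})
    (h : {c : D | IsCoatom c ∧ JoinReducible c}.Subsingleton) : FullyChainRepresentable D := by
  intro Q hQ
  rw [chainRepresentable_iff]
  rcases subsingleton_or_nontrivial D with hD | hD
  · refine ⟨[], fun x => ?_, ?_⟩
    · simpa using fun hx : SupIrred x => hx.ne_bot (Subsingleton.elim _ _)
    · rw [Set.Nonempty.eq_univ ⟨⊥, hQ (.inr (.inl rfl))⟩,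
        Set.Nonempty.eq_univ ⟨_, wordSup_mem_factorSups List.nil_infix⟩]
  obtain ⟨p, hp, hpt⟩ := exists_supIrred_wcovBy_top h
  obtain ⟨L, hL⟩ : ∃ L : List (D × D),
      ∀ q, q ∈ L ↔ SupIrred q.1 ∧ SupIrred q.2 ∧ q.1 ⊔ q.2 ∈ Q :=
    ⟨(Set.toFinite _).toFinset.toList, fun q => by
      rw [Finset.mem_toList, Set.Finite.mem_toFinset]; rfl⟩
  refine ⟨separatedWord p L, fun x => ⟨fun hx => ?_, fun hx => ?_⟩,
    (hW.factorSups_separatedWord_eq hp hpt hQ hL).symm⟩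
  · obtain ⟨q, hq, rfl | rfl | rfl⟩ := mem_separatedWord.1 hx
    exacts [((hL q).1 hq).1, ((hL q).1 hq).2.1, hp]
  · have hxQ : x ⊔ x ∈ Q := (sup_idem x).symm ▸ hQ (.inl hx)
    exact mem_separatedWord.2 ⟨(x, x), (hL _).2 ⟨hx, hx, hxQ⟩, .inl rfl⟩

end WidthLETwo

end Sufficiency

section ChainDecomposition

variable {α : Type*} [PartialOrder α] {s t r : Set α} {a : α}

theorem WidthLETwo.le_or_le_of_not_le (h : WidthLETwo s) (ha : Maximal (· ∈ s) a) {x y : α}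
    (hx : x ∈ s) (hy : y ∈ s) (hxa : ¬x ≤ a) (hya : ¬y ≤ a) : x ≤ y ∨ y ≤ x := by
  have hax : ¬a ≤ x := fun hle => hxa (ha.le_of_ge hx hle)
  have hay : ¬a ≤ y := fun hle => hya (ha.le_of_ge hy hle)
  have := h x hx y hy a ha.prop
  tauto

theorem WidthLETwo.exists_chain_cover_of_maximal (h : WidthLETwo s) (ha : Maximal (· ∈ s) a)
    (hs : t ∪ r = s \ {a}) (ht : IsChain (· ≤ ·) t) (hr : IsChain (· ≤ ·) r)
    (hrt : ∀ y ∈ r, ¬y ≤ a → ∃ p ∈ t, ¬p ≤ a ∧ p ≤ y) :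
    ∃ t' r' : Set α, t' ∪ r' = s ∧ IsChain (· ≤ ·) t' ∧ IsChain (· ≤ ·) r' := by
  have hts : ∀ z ∈ t, z ∈ s := fun z hz => (hs.subset (.inl hz)).1
  have hrs : ∀ z ∈ r, z ∈ s := fun z hz => (hs.subset (.inr hz)).1
  refine ⟨t ∪ {z ∈ r | ¬z ≤ a}, insert a {z ∈ r | z ≤ a}, ?_, ?_, ?_⟩
  · ext z
    have hz : z ∈ t ∨ z ∈ r ↔ z ∈ s ∧ z ≠ a := Set.ext_iff.1 hs z
    have := ha.prop
    simp only [Set.mem_union, Set.mem_insert_iff, Set.mem_sep_iff]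
    grind
  · refine isChain_union.2 ⟨ht, hr.mono (Set.sep_subset _ _), fun z hz y ⟨hy, hya⟩ _ => ?_⟩
    by_cases hza : z ≤ a
    · obtain ⟨p, hp, hpa, hpy⟩ := hrt y hy hya
      rcases ht.total hz hp with hzp | hpz
      · exact .inl (hzp.trans hpy)
      · exact absurd (hpz.trans hza) hpa
    · exact h.le_or_le_of_not_le ha (hts z hz) (hrs y hy) hza hya
  · exact (hr.mono (Set.sep_subset _ _)).insert fun z hz _ => .inr hz.2

theorem WidthLETwo.exists_chain_cover {s : Finset α} (h : WidthLETwo (s : Set α)) :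
    ∃ t r : Set α, t ∪ r = s ∧ IsChain (· ≤ ·) t ∧ IsChain (· ≤ ·) r := by
  classical
  induction s using Finset.strongInduction with
  | H s ih =>
    rcases s.eq_empty_or_nonempty with rfl | hne
    · exact ⟨∅, ∅, by simp, IsChain.empty, IsChain.empty⟩
    obtain ⟨a, ha⟩ := s.exists_maximal hne
    obtain ⟨t, r, htr, ht, hr⟩ := ih (s.erase a) (Finset.erase_ssubset ha.prop)
      fun x hx y hy z hz => h x (Finset.mem_of_mem_erase hx) y (Finset.mem_of_mem_erase hy) z
        (Finset.mem_of_mem_erase hz)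
    rw [Finset.coe_erase] at htr
    by_cases hrt : ∀ y ∈ r, ¬y ≤ a → ∃ p ∈ t, ¬p ≤ a ∧ p ≤ y
    · exact h.exists_chain_cover_of_maximal ha htr ht hr hrt
    · push Not at hrt
      obtain ⟨y, hy, hya, hyt⟩ := hrt
      refine h.exists_chain_cover_of_maximal ha (Set.union_comm r t ▸ htr) hr ht fun p hp hpa => ?_
      exact ⟨y, hy, hya, (h.le_or_le_of_not_le ha (htr.subset (.inl hp)).1
        (htr.subset (.inr hy)).1 hpa hya).resolve_left (hyt p hp hpa)⟩

theorem WidthLETwo.exists_isChain_diff (h : WidthLETwo s) (hs : s.Finite) :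
    ∃ t ⊆ s, IsChain (· ≤ ·) t ∧ IsChain (· ≤ ·) (s \ t) := by
  lift s to Finset α using hs
  obtain ⟨t, r, htr, ht, hr⟩ := h.exists_chain_cover
  exact ⟨t, htr ▸ Set.subset_union_left, ht, hr.mono (Set.sdiff_subset_iff.2 htr.ge)⟩

end ChainDecomposition

section GridDiagram

/-- The point of the plane that represents a pair of natural numbers: the grid is sheared so that
both unit steps lead upwards. -/
def gridPoint (p : ℕ × ℕ) : ℝ × ℝ := (p.1, p.1 + p.2)

theorem gridPoint_injective : Function.Injective gridPoint := fun p q h => by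
  simp only [gridPoint, Prod.mk.injEq, Nat.cast_inj] at h
  refine Prod.ext h.1 ?_
  simpa [h.1] using h.2

theorem floor_ceil_of_mem_openSegment {p q : ℕ × ℕ} (hpq : p ⋖ q) {P : ℝ × ℝ}
    (hP : P ∈ openSegment ℝ (gridPoint p) (gridPoint q)) :
    (⌊P.1⌋₊, ⌊P.2 - P.1⌋₊) = p ∧ (⌈P.1⌉₊, ⌈P.2 - P.1⌉₊) = q := by
  rw [openSegment_eq_image'] at hP
  obtain ⟨θ, ⟨hθ0, hθ1⟩, rfl⟩ := hP
  have floor_add (m : ℕ) : ⌊m + θ⌋₊ = m :=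
    (Nat.floor_eq_iff (by positivity)).2 ⟨by linarith, by linarith⟩
  have ceil_add (m : ℕ) : ⌈m + θ⌉₊ = m + 1 :=
    (Nat.ceil_eq_iff (by omega)).2 ⟨by simpa using hθ0, by push_cast; linarith⟩
  obtain ⟨i, j⟩ := p
  obtain ⟨i', j'⟩ := q
  simp only [Prod.mk_covBy_mk_iff, Nat.covBy_iff_add_one_eq] at hpq
  rcases hpq with ⟨rfl, rfl⟩ | ⟨rfl, rfl⟩
  all_goals simp [gridPoint, add_assoc, floor_add, ceil_add]

theorem eq_or_eq_of_gridPoint_mem_segment {p q r : ℕ × ℕ} (hpq : p ⋖ q)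
    (hr : gridPoint r ∈ segment ℝ (gridPoint p) (gridPoint q)) : r = p ∨ r = q := by
  rw [← insert_endpoints_openSegment] at hr
  rcases hr with h | h | h
  · exact .inl (gridPoint_injective h)
  · exact .inr (gridPoint_injective h)
  · have hfloor := (floor_ceil_of_mem_openSegment hpq h).1
    simp only [gridPoint, add_sub_cancel_left, Nat.floor_natCast, Prod.mk.eta] at hfloor
    exact .inl hfloor

theorem isPlanarDiagram_gridPoint {D : Type*} [PartialOrder D] (f : D ↪o ℕ × ℕ)
    (hf : ∀ a b, a ⋖ b → f a ⋖ f b) : IsPlanarDiagram fun d => gridPoint (f d) := by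
  have vertex_edge {a b v : D} (hab : a ⋖ b)
      (hv : gridPoint (f v) ∈ segment ℝ (gridPoint (f a)) (gridPoint (f b))) : v = a ∨ v = b :=
    (eq_or_eq_of_gridPoint_mem_segment (hf a b hab) hv).imp (f.injective ·) (f.injective ·)
  refine ⟨gridPoint_injective.comp f.injective, fun a b hab => ?_, fun a b v => vertex_edge, ?_⟩
  · have := Prod.lt_iff.1 (f.strictMono hab)
    simp only [gridPoint]
    norm_cast
    omega
  · intro a b c d hab hcd hne P hP hP'
    by_cases hv : ∃ v, P = gridPoint (f v)
    · obtain ⟨v, rfl⟩ := hv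
      exact ⟨v, vertex_edge hab hP, vertex_edge hcd hP', rfl⟩
    rw [← insert_endpoints_openSegment] at hP hP'
    simp only [Set.mem_insert_iff, not_exists.1 hv, false_or] at hP hP'
    obtain ⟨hfloor, hceil⟩ := floor_ceil_of_mem_openSegment (hf a b hab) hP
    obtain ⟨hfloor', hceil'⟩ := floor_ceil_of_mem_openSegment (hf c d hcd) hP'
    exact absurd (Prod.ext (f.injective (hfloor.symm.trans hfloor'))
      (f.injective (hceil.symm.trans hceil'))) hne

end GridDiagram

section CountBelow

variable {D : Type*} {s : Set D}

/-- The number of elements of `s` that are at most `a` (junk value `0` if there are infinitely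
many). -/
noncomputable def countBelow [LE D] (s : Set D) (a : D) : ℕ := {x ∈ s | x ≤ a}.ncard

theorem countBelow_le_iff [Preorder D] (hs : IsChain (· ≤ ·) s) (hfin : s.Finite) {a b : D} :
    countBelow s a ≤ countBelow s b ↔ ∀ x ∈ s, x ≤ a → x ≤ b := by
  refine ⟨fun hle x hx hxa => ?_, fun h => ?_⟩
  · by_contra hxb
    refine hle.not_gt (Set.ncard_lt_ncard ⟨fun y ⟨hy, hyb⟩ => ⟨hy, ?_⟩, fun h => hxb ?_⟩
      (hfin.subset (Set.sep_subset _ _)))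
    · exact ((hs.total hx hy).resolve_left fun hxy => hxb (hxy.trans hyb)).trans hxa
    · exact (h ⟨hx, hxa⟩).2
  · exact Set.ncard_le_ncard (fun y ⟨hy, hya⟩ => ⟨hy, h y hy hya⟩)
      (hfin.subset (Set.sep_subset _ _))

theorem exists_supIrred_le_iff_of_covBy [DistribLattice D] [OrderBot D] [WellFoundedLT D]
    {a b : D} (hab : a ⋖ b) :
    ∃ x, SupIrred x ∧ ¬x ≤ a ∧ ∀ y, SupIrred y → (y ≤ b ↔ y = x ∨ y ≤ a) := by
  obtain ⟨x, hx, hxb, hxa⟩ : ∃ x, SupIrred x ∧ x ≤ b ∧ ¬x ≤ a := by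
    by_contra! hcon
    exact hab.lt.not_ge (le_of_forall_supIrred_le hcon)
  have le_of_not_le {y z : D} (hy : SupIrred y) (hyb : y ≤ b) (hya : ¬y ≤ a) (hzb : z ≤ b)
      (hza : ¬z ≤ a) : y ≤ z := by
    have hsup : a ⊔ z = b := (hab.wcovBy.eq_or_eq le_sup_left (sup_le hab.le hzb)).resolve_left
      fun h => hza (sup_eq_left.1 h)
    exact (hy.supPrime.le_sup.1 (hyb.trans_eq hsup.symm)).resolve_left hya
  refine ⟨x, hx, hxa, fun y hy => ⟨fun hyb => or_iff_not_imp_right.2 fun hya => ?_, ?_⟩⟩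
  · exact (le_of_not_le hy hyb hya hxb hxa).antisymm (le_of_not_le hx hxb hxa hyb hya)
  · rintro (rfl | hya)
    exacts [hxb, hya.trans hab.le]

theorem countBelow_eq_of_le_iff [Preorder D] {a b x : D} (hx : x ∉ s)
    (h : ∀ y ∈ s, (y ≤ b ↔ y = x ∨ y ≤ a)) : countBelow s a = countBelow s b := by
  unfold countBelow
  congr 1
  ext y
  rw [Set.mem_sep_iff, Set.mem_sep_iff]
  grind

theorem countBelow_covBy_of_le_iff [Preorder D] (hfin : s.Finite) {a b x : D} (hx : x ∈ s)
    (hxa : ¬x ≤ a) (h : ∀ y ∈ s, (y ≤ b ↔ y = x ∨ y ≤ a)) :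
    countBelow s a ⋖ countBelow s b := by
  have hins : {y ∈ s | y ≤ b} = insert x {y ∈ s | y ≤ a} := by
    ext y
    rw [Set.mem_insert_iff, Set.mem_sep_iff, Set.mem_sep_iff]
    grind
  have hcard := Set.ncard_insert_of_notMem (a := x) (s := {y ∈ s | y ≤ a}) (fun h => hxa h.2)
    (hfin.subset (Set.sep_subset _ _))
  rw [Nat.covBy_iff_add_one_eq, countBelow, countBelow, hins, hcard]

theorem WidthLETwo.isPlanarOrder [DistribLattice D] [OrderBot D] [Finite D]
    (hW : WidthLETwo {a : D | SupIrred a}) : IsPlanarOrder D := by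
  obtain ⟨t, hts, ht, hr⟩ := hW.exists_isChain_diff (Set.toFinite _)
  let r := {a : D | SupIrred a} \ t
  have hf (a b : D) :
      (countBelow t a, countBelow r a) ≤ (countBelow t b, countBelow r b) ↔ a ≤ b := by
    rw [Prod.mk_le_mk, countBelow_le_iff ht (Set.toFinite _), countBelow_le_iff hr (Set.toFinite _)]
    refine ⟨fun ⟨h1, h2⟩ => le_of_forall_supIrred_le fun x hx => ?_,
      fun hab => ⟨fun x _ hxa => hxa.trans hab, fun x _ hxa => hxa.trans hab⟩⟩
    by_cases hxt : x ∈ t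
    exacts [h1 x hxt, h2 x ⟨hx, hxt⟩]
  refine ⟨inferInstance, _, isPlanarDiagram_gridPoint (.ofMapLEIff _ hf) fun a b hab =>
    Prod.mk_covBy_mk_iff.2 ?_⟩
  obtain ⟨x, hx, hxa, hxb⟩ := exists_supIrred_le_iff_of_covBy hab
  by_cases hxt : x ∈ t
  · exact .inl ⟨countBelow_covBy_of_le_iff (Set.toFinite _) hxt hxa fun y hy => hxb y (hts hy),
      countBelow_eq_of_le_iff (fun h => h.2 hxt) fun y hy => hxb y hy.1⟩
  · exact .inr ⟨countBelow_covBy_of_le_iff (Set.toFinite _) ⟨hx, hxt⟩ hxa fun y hy => hxb y hy.1,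
      countBelow_eq_of_le_iff hxt fun y hy => hxb y (hts hy)⟩

end CountBelow

section Paths

/-- The inverse slope of the line through two points of the plane (junk value `0` if they have the
same height). -/
noncomputable def invSlope (P Q : ℝ × ℝ) : ℝ := (Q.1 - P.1) / (Q.2 - P.2)

/-- The first coordinate at height `y` of the line through two points of the plane: edges of a
diagram are regarded as graphs over the vertical axis. -/
noncomputable def lineAt (P Q : ℝ × ℝ) (y : ℝ) : ℝ := P.1 + (y - P.2) * invSlope P Q

theorem continuous_lineAt (P Q : ℝ × ℝ) : Continuous (lineAt P Q) := by
  unfold lineAt; fun_prop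

theorem lineAt_left (P Q : ℝ × ℝ) : lineAt P Q P.2 = P.1 := by simp [lineAt]

theorem lineAt_right {P Q : ℝ × ℝ} (h : P.2 < Q.2) : lineAt P Q Q.2 = Q.1 := by
  rw [lineAt, invSlope, mul_div_cancel₀ _ (sub_pos.2 h).ne', add_sub_cancel]

theorem lineAt_mem_segment {P Q : ℝ × ℝ} (h : P.2 < Q.2) {y : ℝ} (hy : y ∈ Set.Icc P.2 Q.2) :
    (lineAt P Q y, y) ∈ segment ℝ P Q := by
  have h0 : 0 < Q.2 - P.2 := sub_pos.2 h
  rw [segment_eq_image']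
  refine ⟨(y - P.2) / (Q.2 - P.2), ⟨div_nonneg (sub_nonneg.2 hy.1) h0.le, ?_⟩, Prod.ext ?_ ?_⟩
  · exact (div_le_one h0).2 (sub_le_sub_right hy.2 _)
  · simp only [lineAt, invSlope, Prod.fst_add, Prod.smul_fst, Prod.fst_sub, smul_eq_mul]
    ring
  · simp only [Prod.snd_add, Prod.smul_snd, Prod.snd_sub, smul_eq_mul]
    rw [div_mul_cancel₀ _ h0.ne', add_sub_cancel]

theorem lt_of_continuous_of_ne {f g : ℝ → ℝ} (hf : Continuous f) (hg : Continuous g) {s t : ℝ}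
    (hst : s ≤ t) (hs : f s < g s) (hne : ∀ y ∈ Set.Icc s t, f y ≠ g y) : f t < g t := by
  by_contra! ht
  obtain ⟨y, hy, hfg⟩ := isPreconnected_Icc.intermediate_value₂ (Set.left_mem_Icc.2 hst)
    (Set.right_mem_Icc.2 hst) hf.continuousOn hg.continuousOn hs.le ht
  exact hne y hy hfg

variable {D : Type*}

/-- The function `φ`, restricted to the heights between those of `x` and `d`, is the graph (over
the vertical axis) of a path along edges of the diagram `pos` that leaves `x` along `x ⋖ a` and
then climbs to `d`. -/
structure IsPath [PartialOrder D] (pos : D → ℝ × ℝ) (x a d : D) (φ : ℝ → ℝ) : Prop where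
  continuous : Continuous φ
  eq_lineAt : ∀ y ≤ (pos a).2, φ y = lineAt (pos x) (pos a) y
  apply_last : φ (pos d).2 = (pos d).1
  mem_edge : ∀ y ∈ Set.Icc (pos x).2 (pos d).2, ∃ u v, u ⋖ v ∧ (u = x ∨ a ≤ u) ∧ a ≤ v ∧ v ≤ d ∧
    (φ y, y) ∈ segment ℝ (pos u) (pos v)

namespace IsPlanarDiagram

section PartialOrder

variable [PartialOrder D] {pos : D → ℝ × ℝ} {x a b d e : D}

theorem height_le (h : IsPlanarDiagram pos) (hab : a ≤ b) : (pos a).2 ≤ (pos b).2 := by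
  rcases hab.eq_or_lt with rfl | hab
  exacts [le_rfl, (h.upward a b hab).le]

theorem eq_of_invSlope_eq (h : IsPlanarDiagram pos) (ha : x ⋖ a) (hb : x ⋖ b)
    (hs : invSlope (pos x) (pos a) = invSlope (pos x) (pos b)) : a = b := by
  wlog hle : (pos a).2 ≤ (pos b).2 generalizing a b
  · exact (this hb ha hs.symm (le_of_not_ge hle)).symm
  have hxa := h.upward x a ha.lt
  have hmem := lineAt_mem_segment (h.upward x b hb.lt) ⟨hxa.le, hle⟩
  have hline : lineAt (pos x) (pos b) (pos a).2 = (pos a).1 := by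
    rw [← lineAt_right hxa, lineAt, lineAt, hs]
  rw [hline] at hmem
  exact (h.vertex_edge x b a hb hmem).resolve_left ha.lt.ne'

theorem exists_isPath [LocallyFiniteOrder D] (h : IsPlanarDiagram pos) (hxa : x ⋖ a)
    (had : a ≤ d) : ∃ φ, IsPath pos x a d φ := by
  induction le_iff_reflTransGen_covBy.1 had with
  | refl =>
    have hxa' := h.upward x a hxa.lt
    exact ⟨lineAt (pos x) (pos a), continuous_lineAt _ _, fun _ _ => rfl, lineAt_right hxa',
      fun y hy => ⟨x, a, hxa, .inl rfl, le_rfl, le_rfl, lineAt_mem_segment hxa' hy⟩⟩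
  | @tail b c hab hbc ih =>
    have hab := le_iff_reflTransGen_covBy.2 hab
    obtain ⟨φ, hφ⟩ := ih hab
    have hbc' := h.upward b c hbc.lt
    refine ⟨fun y => if y ≤ (pos b).2 then φ y else lineAt (pos b) (pos c) y, ?_, ?_, ?_, ?_⟩
    · refine hφ.continuous.if_le (continuous_lineAt _ _) continuous_id continuous_const ?_
      rintro y rfl
      rw [lineAt_left, hφ.apply_last]
    · intro y hy
      rw [if_pos (hy.trans (h.height_le hab)), hφ.eq_lineAt y hy]
    · rw [if_neg hbc'.not_ge, lineAt_right hbc']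
    · intro y hy
      split_ifs with hyb
      · obtain ⟨u, v, huv, hu, hav, hvb, hmem⟩ := hφ.mem_edge y ⟨hy.1, hyb⟩
        exact ⟨u, v, huv, hu, hav, hvb.trans hbc.le, hmem⟩
      · exact ⟨b, c, hbc, .inr hab, hab.trans hbc.le, le_rfl,
          lineAt_mem_segment hbc' ⟨(not_le.1 hyb).le, hy.2⟩⟩

/-- A common point of the paths is an endpoint of an edge of both. An endpoint other than `x` on the
second path lies above `b`, while all endpoints on the first path lie below `d`. -/
theorem ne_of_isPath (h : IsPlanarDiagram pos) (hbd : ¬b ≤ d) {φ ψ : ℝ → ℝ}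
    (hφ : IsPath pos x a d φ) (hψ : IsPath pos x b e ψ) {y : ℝ} (hxy : (pos x).2 < y)
    (hyd : y ≤ (pos d).2) (hye : y ≤ (pos e).2) : φ y ≠ ψ y := by
  intro heq
  obtain ⟨u, v, huv, -, -, hvd, hmem⟩ := hφ.mem_edge y ⟨hxy.le, hyd⟩
  obtain ⟨u', v', huv', hu', hbv', -, hmem'⟩ := hψ.mem_edge y ⟨hxy.le, hye⟩
  have hedges : (u, v) ≠ (u', v') := fun he =>
    hbd (hbv'.trans ((Prod.mk.inj he).2.ge.trans hvd))
  obtain ⟨w, hw, hw', hpos⟩ := h.edge_edge u v u' v' huv huv' hedges _ hmem (heq ▸ hmem')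
  have hwd : w ≤ d := by
    rcases hw with rfl | rfl
    exacts [huv.le.trans hvd, hvd]
  have hwx : w = x := by
    rcases hw' with rfl | rfl
    · exact hu'.resolve_right fun hbw => hbd (hbw.trans hwd)
    · exact absurd (hbv'.trans hwd) hbd
  subst hwx
  exact hxy.ne' (congrArg Prod.snd hpos)

theorem lt_of_isPath (h : IsPlanarDiagram pos) (ha : x ⋖ a) (hb : x ⋖ b) {φ ψ : ℝ → ℝ}
    (hφ : IsPath pos x a d φ) (hψ : IsPath pos x b e ψ)
    (hs : invSlope (pos x) (pos a) < invSlope (pos x) (pos b)) {t : ℝ} (ht : (pos x).2 < t)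
    (hne : ∀ y ∈ Set.Ioc (pos x).2 t, φ y ≠ ψ y) : φ t < ψ t := by
  obtain ⟨s, hxs, hs'⟩ : ∃ s, (pos x).2 < s ∧ s ≤ min t (min (pos a).2 (pos b).2) :=
    ⟨_, lt_min ht (lt_min (h.upward x a ha.lt) (h.upward x b hb.lt)), le_rfl⟩
  simp only [le_min_iff] at hs'
  refine lt_of_continuous_of_ne hφ.continuous hψ.continuous hs'.1 ?_
    fun y hy => hne y ⟨hxs.trans_le hy.1, hy.2⟩
  rw [hφ.eq_lineAt s hs'.2.1, hψ.eq_lineAt s hs'.2.2, lineAt, lineAt]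
  gcongr

end PartialOrder

variable [SemilatticeSup D] [LocallyFiniteOrder D] {pos : D → ℝ × ℝ} {x a b c : D}

/-- Otherwise the paths from `x` to `a ⊔ c` through `a` and through `c` enclose the edge from `x` to
`b`, and a path from `b` to `b ⊔ (a ⊔ c)` cannot leave the enclosed region. -/
theorem le_sup_of_invSlope_lt_of_lt (h : IsPlanarDiagram pos) (ha : x ⋖ a) (hb : x ⋖ b) (hc : x ⋖ c)
    (hab : invSlope (pos x) (pos a) < invSlope (pos x) (pos b))
    (hbc : invSlope (pos x) (pos b) < invSlope (pos x) (pos c)) : b ≤ a ⊔ c := by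
  by_contra hbd
  obtain ⟨φ, hφ⟩ := h.exists_isPath ha (le_sup_left : a ≤ a ⊔ c)
  obtain ⟨χ, hχ⟩ := h.exists_isPath hc (le_sup_right : c ≤ a ⊔ c)
  obtain ⟨ψ, hψ⟩ := h.exists_isPath hb (le_sup_left : b ≤ b ⊔ (a ⊔ c))
  have hle : (pos (a ⊔ c)).2 ≤ (pos (b ⊔ (a ⊔ c))).2 := h.height_le le_sup_right
  have hlt : (pos x).2 < (pos (a ⊔ c)).2 := h.upward _ _ (ha.lt.trans_le le_sup_left)
  have hφψ := h.lt_of_isPath ha hb hφ hψ hab hlt fun y hy =>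
    h.ne_of_isPath hbd hφ hψ hy.1 hy.2 (hy.2.trans hle)
  have hψχ := h.lt_of_isPath hb hc hψ hχ hbc hlt fun y hy =>
    (h.ne_of_isPath hbd hχ hψ hy.1 hy.2 (hy.2.trans hle)).symm
  rw [hφ.apply_last] at hφψ
  rw [hχ.apply_last] at hψχ
  exact lt_asymm hφψ hψχ

theorem le_sup_of_invSlope_le_of_le (h : IsPlanarDiagram pos) (ha : x ⋖ a) (hb : x ⋖ b)
    (hc : x ⋖ c) (hab : invSlope (pos x) (pos a) ≤ invSlope (pos x) (pos b))
    (hbc : invSlope (pos x) (pos b) ≤ invSlope (pos x) (pos c)) : b ≤ a ⊔ c := by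
  rcases hab.eq_or_lt with hab | hab
  · exact (h.eq_of_invSlope_eq ha hb hab).ge.trans le_sup_left
  rcases hbc.eq_or_lt with hbc | hbc
  · exact (h.eq_of_invSlope_eq hb hc hbc).le.trans le_sup_right
  · exact h.le_sup_of_invSlope_lt_of_lt ha hb hc hab hbc

theorem le_sup_of_three_covBy (h : IsPlanarDiagram pos) (ha : x ⋖ a) (hb : x ⋖ b) (hc : x ⋖ c) :
    a ≤ b ⊔ c ∨ b ≤ a ⊔ c ∨ c ≤ a ⊔ b := by
  have := h.le_sup_of_invSlope_le_of_le ha hb hc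
  have := h.le_sup_of_invSlope_le_of_le hc hb ha
  have := h.le_sup_of_invSlope_le_of_le hb ha hc
  have := h.le_sup_of_invSlope_le_of_le hc ha hb
  have := h.le_sup_of_invSlope_le_of_le ha hc hb
  have := h.le_sup_of_invSlope_le_of_le hb hc ha
  grind

end IsPlanarDiagram

end Paths

section NoThreeCovers

variable {D : Type*} [DistribLattice D]

theorem covBy_sup_of_maximal {s : Set D} (hs : ∀ a ∈ s, SupIrred a) (hanti : IsAntichain (· ≤ ·) s)
    {x a : D} (hx : Maximal (fun x => ∀ a ∈ s, ¬a ≤ x) x) (ha : a ∈ s) : x ⋖ x ⊔ a := by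
  refine ⟨left_lt_sup.2 (hx.prop a ha), fun z hxz hza => ?_⟩
  obtain ⟨b, hb, hbz⟩ : ∃ b ∈ s, b ≤ z := by
    by_contra! hcon
    exact hxz.not_ge (hx.le_of_ge hcon hxz.le)
  have hba : b ≤ a := ((hs b hb).supPrime.le_sup.1 (hbz.trans hza.le)).resolve_left (hx.prop b hb)
  obtain rfl := hanti.eq hb ha hba
  exact hza.not_ge (sup_le hxz.le hbz)

theorem IsPlanarOrder.widthLETwo [OrderBot D] (h : IsPlanarOrder D) :
    WidthLETwo {a : D | SupIrred a} := by
  classical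
  obtain ⟨hfin, pos, hpos⟩ := h
  have := Fintype.ofFinite D
  let := Fintype.toLocallyFiniteOrder (α := D)
  intro a ha b hb c hc
  by_contra! hcon
  obtain ⟨hab, hba, hac, hca, hbc, hcb⟩ := hcon
  have hs : ∀ d ∈ ({a, b, c} : Set D), SupIrred d := by
    rintro d (rfl | rfl | rfl)
    exacts [ha, hb, hc]
  have hanti : IsAntichain (· ≤ ·) ({a, b, c} : Set D) := by
    simp [isAntichain_insert, *]
  obtain ⟨x, -, hx⟩ := Finite.exists_le_maximal (p := fun x => ∀ d ∈ ({a, b, c} : Set D), ¬d ≤ x)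
    (a := ⊥) fun d hd h => (hs d hd).ne_bot (le_bot_iff.1 h)
  have hax := hx.prop a (by simp)
  have hbx := hx.prop b (by simp)
  have hcx := hx.prop c (by simp)
  have := hpos.le_sup_of_three_covBy (covBy_sup_of_maximal hs hanti hx (a := a) (by simp))
    (covBy_sup_of_maximal hs hanti hx (a := b) (by simp))
    (covBy_sup_of_maximal hs hanti hx (a := c) (by simp))
  simp only [sup_le_iff, ha.supPrime.le_sup, hb.supPrime.le_sup, hc.supPrime.le_sup] at this
  tauto

end NoThreeCovers

theorem proposition1p5_general {D : Type*} [DistribLattice D] [BoundedOrder D] :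
    FullyChainRepresentable D ↔
      IsPlanarOrder D ∧ {c : D | IsCoatom c ∧ JoinReducible c}.Subsingleton := by
  constructor
  · intro h
    have := h.finite
    exact ⟨h.widthLETwo.isPlanarOrder, h.subsingleton_joinReducible_coatom⟩
  · rintro ⟨hp, hc⟩
    have := hp.1
    exact hp.widthLETwo.fullyChainRepresentable hc

theorem proposition1p5 {D : Type*} [DistribLattice D] [BoundedOrder D] [Finite D] :
    FullyChainRepresentable D ↔
      IsPlanarOrder D ∧ {c : D | IsCoatom c ∧ JoinReducible c}.Subsingleton :=
  proposition1p5_general
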